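/- Let $G$ be a (discrete) group. Let $r\mathcal G$ be the groupoid whose objects are the elements of $G$ and whose morphisms are $\mathrm{Mor}(a,b)=\{x\in G : ax=b\}$, the composite of $x\colon a\to b$ and $y\colon b\to c$ being $xy$; the group $G$ acts on $r\mathcal G$ by left translations, $h$ sending $a$ to $ha$ and $x\colon a\to b$ to $x\colon ha\to hb$. Regard $G$ also as a category with a single object, with morphisms the elements of $G$ and with composite of $x$ followed by $y$ equal to $yx$. For a category $\mathcal C$ let $B\mathcal C$ be its classifying space, i.e. the geometric realization of its nerve; write $BG$ and $Br\mathcal G$ for the classifying spaces of the one-object category $G$ and of $r\mathcal G$. Then: 1. $BG$ is an Eilenberg–MacLane complex $K(G,1)$: it is a path-connected CW complex, $\pi_1(BG,p)\cong G$ and $\pi_n(BG,p)=0$ for all $n\ge 2$ and every base point $p$. 2. $BG\approx (Br\mathcal G)/G$: the functor $r\mathcal G\to G$ that sends each morphism $x\colon a\to b$ to $x^{-1}$ induces a homeomorphism from the orbit space $(Br\mathcal G)/G$, with the quotient topology, onto $BG$. -/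

import Mathlib

open CategoryTheory

universe u

/-- The objects of the groupoid `r𝒢` of the right action of `G` on itself: the elements of `G`. -/
structure RightGroupoid (G : Type u) : Type u where
  /-- the underlying element of `G` -/
  elt : G

namespace RightGroupoid

variable {G : Type u} [Group G]

/-- `Mor(a, b) = {x : a x = b}`; the composite of `x : a → b` and `y : b → c` is `x y`. -/
instance : Groupoid (RightGroupoid G) where
  Hom a b := {x : G // a.elt * x = b.elt}
  id a := ⟨1, mul_one a.elt⟩
  comp {a b c} x y := ⟨x.1 * y.1, by rw [← mul_assoc, x.2, y.2]⟩
  id_comp x := Subtype.ext (one_mul x.1)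
  comp_id x := Subtype.ext (mul_one x.1)
  assoc x y z := Subtype.ext (mul_assoc x.1 y.1 z.1)
  inv {a b} x := ⟨x.1⁻¹, mul_inv_eq_of_eq_mul x.2.symm⟩
  inv_comp x := Subtype.ext (inv_mul_cancel x.1)
  comp_inv x := Subtype.ext (mul_inv_cancel x.1)

/-- Left translation by `h : G`: it sends the object `a` to `h a` and the morphism
`x : a → b` to the morphism `x : h a → h b`. -/
def translate (h : G) : RightGroupoid G ⥤ RightGroupoid G where
  obj a := ⟨h * a.elt⟩
  map {a b} x := ⟨x.1, by rw [mul_assoc, x.2]⟩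

theorem hom_eq {a b : RightGroupoid G} (x y : a ⟶ b) : x = y :=
  Subtype.ext (mul_left_cancel (x.2.trans y.2.symm))

theorem translate_one : translate (1 : G) = 𝟭 (RightGroupoid G) :=
  CategoryTheory.Functor.ext (fun a ↦ congrArg mk (one_mul a.elt)) fun _ _ _ ↦ hom_eq _ _

theorem translate_mul (h k : G) : translate (h * k) = translate k ⋙ translate h :=
  CategoryTheory.Functor.ext (fun a ↦ congrArg mk (mul_assoc h k a.elt)) fun _ _ _ ↦ hom_eq _ _

/-- The projection of `r𝒢` onto `G` as a one-object category. In `SingleObj G` the composite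
of `x` followed by `y` is `y x`, so the morphism `x : a → b` is sent to `x⁻¹`. -/
def proj (G : Type u) [Group G] : RightGroupoid G ⥤ SingleObj G where
  obj _ := SingleObj.star G
  map x := (x.1⁻¹ : G)
  map_id _ := inv_one
  map_comp x y := mul_inv_rev x.1 y.1

/-- The map of nerves induced by `proj`. -/
def nerveProj (G : Type u) [Group G] : nerve (RightGroupoid G) ⟶ nerve (SingleObj G) where
  app _ := ↾fun (σ : ComposableArrows (RightGroupoid G) _) ↦ σ ⋙ proj G

end RightGroupoid

/-- The classifying space of a category: the geometric realization of its nerve. -/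
noncomputable abbrev classifyingSpace (C : Type*) [Category C] : TopCat :=
  SSet.toTop.obj (nerve C)

/-- The classifying space `Br𝒢`. -/
noncomputable def BrG (G : Type u) [Group G] : TopCat.{u} :=
  classifyingSpace (RightGroupoid G)

/-- The classifying space `BG` of the group `G`, viewed as a category with one object. -/
noncomputable def BG (G : Type u) [Group G] : TopCat.{u} :=
  classifyingSpace (SingleObj G)

/-- The action of `G` on `Br𝒢` induced by left translations of the groupoid `r𝒢`. -/
noncomputable instance (G : Type u) [Group G] : MulAction G (BrG G) where
  smul h p := (SSet.toTop.map (nerveMap (RightGroupoid.translate h))).hom p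
  one_smul p := by
    change (SSet.toTop.map (nerveMap (RightGroupoid.translate (1 : G)))).hom p = p
    rw [RightGroupoid.translate_one]
    exact congrArg (fun f ↦ f.hom p) (SSet.toTop.map_id (nerve (RightGroupoid G)))
  mul_smul h k p := by
    change (SSet.toTop.map (nerveMap (RightGroupoid.translate (h * k)))).hom p =
      (SSet.toTop.map (nerveMap (RightGroupoid.translate h))).hom
        ((SSet.toTop.map (nerveMap (RightGroupoid.translate k))).hom p)
    rw [RightGroupoid.translate_mul]
    exact congrArg (fun f ↦ f.hom p) (SSet.toTop.map_comp
      (nerveMap (RightGroupoid.translate k)) (nerveMap (RightGroupoid.translate h)))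

/-- The map `Br𝒢 → BG` induced by the projection of `r𝒢` onto the one-object category `G`. -/
noncomputable def BrG.toBG (G : Type u) [Group G] : C(BrG G, BG G) :=
  (SSet.toTop.map (RightGroupoid.nerveProj G)).hom

/-- `X` is an Eilenberg–MacLane complex of type `K(G, 1)`: a path connected CW complex with
fundamental group isomorphic to `G` and with trivial higher homotopy groups. -/
structure IsEilenbergMacLaneOne (G : Type u) [Group G] (X : TopCat.{u}) : Prop where
  cwComplex : Nonempty (TopCat.CWComplex X)
  pathConnected : PathConnectedSpace X
  pi_one (x : X) : Nonempty (HomotopyGroup.Pi 1 X x ≃* G)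
  pi_higher (n : ℕ) (hn : 2 ≤ n) (x : X) : Subsingleton (HomotopyGroup.Pi n X x)

/-! Any two objects of `RightGroupoid G` are joined by exactly one morphism, so an n-simplex of its
nerve is an arbitrary (n+1)-tuple in G, with G acting by left multiplication. `proj` keeps only the
ratios of the entries, so the simplices of the nerve of the one-object category are exactly the
G-orbits. The universal property of realization turns this into `BrG.orbitHomeo`.

The action is a covering action (`BrG.isQuotientCoveringMap_toBG`). A point of Br𝒢 is read as a
G-valued step function on [0, 1]; the length of the part of [a, b] on which its value is g is a
continuous function (`BrG.weight`) compatible with translation, and two distinct values cannot both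
fill more than half of [a, b]. Coning off to the vertex 1 contracts Br𝒢. Hence π₁(BG) is the deck
group G, and a higher sphere in BG lifts to Br𝒢 and dies there
(`IsCoveringMap.subsingleton_homotopyGroup`).

For the CW structure, realization is a left adjoint and carries the skeletal cell structure of a
simplicial set to a topological one, once |∂Δⁿ| → |Δⁿ| is identified with the inclusion of the
sphere in the disk (`SSet.nonempty_boundary_arrow_iso`). -/

section ClassifyingSpace

open Simplicial Opposite

/-! ### Points of a realization and maps out of it. -/

namespace SSet

/-- The characteristic map of the simplex `σ` of `X` in the geometric realization of `X`. -/
noncomputable def realizationMk {X : SSet.{u}} {n : SimplexCategory} (σ : X.obj (op n)) :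
    C(_root_.stdSimplex ℝ (Fin (n.len + 1)), |X|) :=
  TopCat.toSSetObjEquiv |X| (op n) ((sSetTopAdj.unit.app X).app (op n) σ)

theorem realizationMk_map {X : SSet.{u}} {n m : SimplexCategory} (f : m ⟶ n) (σ : X.obj (op n))
    (t : _root_.stdSimplex ℝ (Fin (m.len + 1))) :
    realizationMk (X.map f.op σ) t = realizationMk σ (_root_.stdSimplex.map f t) := by
  have h := NatTrans.naturality_apply (sSetTopAdj.unit.app X) f.op σ
  exact congrArg (fun z ↦ TopCat.toSSetObjEquiv |X| (op m) z t) h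

theorem toTop_map_realizationMk {X Y : SSet.{u}} (g : X ⟶ Y) {n : SimplexCategory}
    (σ : X.obj (op n)) (t : _root_.stdSimplex ℝ (Fin (n.len + 1))) :
    (SSet.toTop.map g).hom (realizationMk σ t) = realizationMk (g.app (op n) σ) t := by
  have h := ConcreteCategory.congr_hom (NatTrans.congr_app (sSetTopAdj.unit.naturality g) (op n)) σ
  exact (congrArg (fun z ↦ TopCat.toSSetObjEquiv |Y| (op n) z t) h).symm

/-- The continuous map out of a realization given by a compatible family of maps out of
topological simplices. -/
noncomputable def realizationDesc {X : SSet.{u}} {Y : TopCat.{u}} (φ : X ⟶ TopCat.toSSet.obj Y) :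
    C(|X|, Y) :=
  ((sSetTopAdj.homEquiv X Y).symm φ).hom

theorem realizationDesc_mk {X : SSet.{u}} {Y : TopCat.{u}} (φ : X ⟶ TopCat.toSSet.obj Y)
    {n : SimplexCategory} (σ : X.obj (op n)) (t : _root_.stdSimplex ℝ (Fin (n.len + 1))) :
    realizationDesc φ (realizationMk σ t) = TopCat.toSSetObjEquiv Y (op n) (φ.app (op n) σ) t := by
  have h : φ = sSetTopAdj.homEquiv X Y ((sSetTopAdj.homEquiv X Y).symm φ) := by simp
  rw [Adjunction.homEquiv_unit] at h
  conv_rhs => rw [h]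
  rfl

theorem realization_hom_ext {X : SSet.{u}} {Y : Type u} [TopologicalSpace Y] {f g : C(|X|, Y)}
    (h : ∀ (n : SimplexCategory) (σ : X.obj (op n)) (t : _root_.stdSimplex ℝ (Fin (n.len + 1))),
      f (realizationMk σ t) = g (realizationMk σ t)) : f = g := by
  have : (TopCat.ofHom f : |X| ⟶ TopCat.of Y) = TopCat.ofHom g := by
    apply (sSetTopAdj.homEquiv X (TopCat.of Y)).injective
    rw [Adjunction.homEquiv_unit, Adjunction.homEquiv_unit]
    ext ⟨n⟩ σ
    apply (TopCat.toSSetObjEquiv (TopCat.of Y) (op n)).injective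
    ext t
    exact h n σ t
  exact congrArg TopCat.Hom.hom this

/-- Every map to an indiscrete space is continuous, so uniqueness of maps out of the realization
applies to predicates: "lies in some simplex" and "true" agree on all simplices, hence everywhere.
-/
theorem exists_realizationMk_eq {X : SSet.{u}} (p : |X|) :
    ∃ (n : SimplexCategory) (σ : X.obj (op n)) (t : _root_.stdSimplex ℝ (Fin (n.len + 1))),
      realizationMk σ t = p := by
  let _ : TopologicalSpace (ULift.{u} Prop) := ⊤
  let f : C(|X|, ULift.{u} Prop) := ⟨fun p ↦ ⟨∃ (n : SimplexCategory) (σ : X.obj (op n))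
    (t : _root_.stdSimplex ℝ (Fin (n.len + 1))), realizationMk σ t = p⟩, continuous_top⟩
  let g : C(|X|, ULift.{u} Prop) := ⟨fun p ↦ ⟨True⟩, continuous_top⟩
  have h : f = g := realization_hom_ext fun n σ t ↦
    congrArg ULift.up (eq_true ⟨n, σ, t, rfl⟩)
  exact of_eq_true (congrArg ULift.down (DFunLike.congr_fun h p))

theorem toTopHomeo_realizationMk {n m : SimplexCategory} (σ : (stdSimplex.{u}.obj n).obj (op m))
    (t : _root_.stdSimplex ℝ (Fin (m.len + 1))) :
    n.toTopHomeo (realizationMk σ t) = _root_.stdSimplex.map (stdSimplex.objEquiv σ) t := by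
  have h : realizationMk σ t =
      SSet.toTop.map (SSet.stdSimplex.map (stdSimplex.objEquiv σ)) (m.toTopHomeo.symm t) := by
    have h1 := sSetTopAdj_unit_app_app_down (stdSimplex.{u}.obj n) (op m) σ
    have h2 : yonedaEquiv.symm σ = SSet.stdSimplex.map (SSet.stdSimplex.objEquiv σ) := by
      apply yonedaEquiv.injective
      rw [Equiv.apply_symm_apply, SSet.yonedaEquiv_map]
      exact (Equiv.symm_apply_apply _ _).symm
    rw [h2] at h1
    exact ConcreteCategory.congr_hom h1 (ULift.up t)
  rw [h, SimplexCategory.toTopHomeo_naturality_apply, Homeomorph.apply_symm_apply]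

end SSet

/-! ### Simplices of the two nerves. -/

namespace RightGroupoid

variable {G : Type u} [Group G]

/-- A simplex of the nerve of `r𝒢` is the sequence of its vertices. -/
def nerveEquivFun (n : SimplexCategory) :
    (nerve (RightGroupoid G)).obj (op n) ≃ (Fin (n.len + 1) → G) where
  toFun (σ : ComposableArrows (RightGroupoid G) n.len) := fun i ↦ (σ.obj i).elt
  invFun g :=
    { obj i := ⟨g i⟩
      map {i j} _ := ⟨(g i)⁻¹ * g j, mul_inv_cancel_left (g i) (g j)⟩
      map_id _ := hom_eq _ _
      map_comp _ _ := hom_eq _ _ }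
  left_inv _ := CategoryTheory.Functor.ext (fun _ ↦ rfl) fun _ _ _ ↦ hom_eq _ _
  right_inv _ := rfl

theorem nerveEquivFun_map {n m : SimplexCategory} (f : m ⟶ n)
    (σ : (nerve (RightGroupoid G)).obj (op n)) :
    nerveEquivFun m ((nerve (RightGroupoid G)).map f.op σ) = nerveEquivFun n σ ∘ f :=
  rfl

theorem nerveEquivFun_translate (h : G) {n : SimplexCategory}
    (σ : (nerve (RightGroupoid G)).obj (op n)) (i : Fin (n.len + 1)) :
    nerveEquivFun n ((nerveMap (translate h)).app (op n) σ) i = h * nerveEquivFun n σ i :=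
  rfl

/-- The element of `G` given by a morphism of the one-object category `G`. -/
def ofHom {a b : SingleObj G} (x : a ⟶ b) : G := x

theorem ofHom_comp {a b c : SingleObj G} (x : a ⟶ b) (y : b ⟶ c) :
    ofHom (x ≫ y) = ofHom y * ofHom x := rfl

theorem functor_ext_ofHom {J : Type*} [Category* J] {F F' : J ⥤ SingleObj G}
    (h : ∀ {i j : J} (x : i ⟶ j), ofHom (F.map x) = ofHom (F'.map x)) : F = F' :=
  CategoryTheory.Functor.ext (fun _ ↦ rfl) fun i j x ↦ by
    have := h x
    simp only [eqToHom_refl]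
    exact this.trans ((mul_one _).trans (one_mul _)).symm

theorem nerveProj_surjective (n : SimplexCategory) :
    Function.Surjective ((nerveProj G).app (op n)) := by
  intro (τ : ComposableArrows (SingleObj G) n.len)
  -- The lift whose initial vertex is 1; the other vertices are then forced.
  let σ : ComposableArrows (RightGroupoid G) n.len :=
    { obj i := ⟨(ofHom (τ.map (homOfLE (Fin.zero_le i))))⁻¹⟩
      map {i j} x := ⟨(ofHom (τ.map x))⁻¹, by
        rw [← mul_inv_rev, ← ofHom_comp, ← τ.map_comp]
        rfl⟩
      map_id _ := hom_eq _ _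
      map_comp _ _ := hom_eq _ _ }
  exact ⟨σ, functor_ext_ofHom (F := σ ⋙ proj G) (F' := τ) fun x ↦ inv_inv (ofHom (τ.map x))⟩

/-- The initial vertex and the edges issuing from it determine all vertices. Equal projections mean
equal edges, so the translation matching the initial vertices matches the simplices. -/
theorem exists_translate_of_nerveProj_eq {n : SimplexCategory}
    {σ σ' : (nerve (RightGroupoid G)).obj (op n)}
    (hσ : (nerveProj G).app (op n) σ = (nerveProj G).app (op n) σ') :
    ∃ h : G, (nerveMap (translate h)).app (op n) σ = σ' := by
  let s : ComposableArrows (RightGroupoid G) n.len := σ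
  let s' : ComposableArrows (RightGroupoid G) n.len := σ'
  refine ⟨(s'.obj 0).elt * (s.obj 0).elt⁻¹, (nerveEquivFun n).injective (funext fun i ↦ ?_)⟩
  rw [nerveEquivFun_translate]
  change _ * (s.obj i).elt = (s'.obj i).elt
  have hp : s ⋙ proj G = s' ⋙ proj G := hσ
  let x := s.map (homOfLE (Fin.zero_le i))
  let x' := s'.map (homOfLE (Fin.zero_le i))
  have h1 : (s.obj 0).elt * x.1 = (s.obj i).elt := x.2
  have h2 : (s'.obj 0).elt * x'.1 = (s'.obj i).elt := x'.2
  have h3 : x.1 = x'.1 := inv_injective <|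
    congrArg (fun F : Fin (n.len + 1) ⥤ SingleObj G ↦ ofHom (F.map (homOfLE (Fin.zero_le i)))) hp
  rw [← h1, ← h2, h3, mul_assoc, inv_mul_cancel_left]

end RightGroupoid

/-! ### The orbit space of Br𝒢 and BG. -/

namespace BrG

variable {G : Type u} [Group G]

open SSet

/-- The characteristic map of a simplex of `r𝒢` in `Br𝒢`. -/
noncomputable def mk {n : SimplexCategory} (σ : (nerve (RightGroupoid G)).obj (op n)) :
    C(_root_.stdSimplex ℝ (Fin (n.len + 1)), BrG G) :=
  realizationMk σ

theorem exists_mk_eq (p : BrG G) : ∃ (n : SimplexCategory)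
    (σ : (nerve (RightGroupoid G)).obj (op n)) (t : _root_.stdSimplex ℝ (Fin (n.len + 1))),
      mk σ t = p :=
  exists_realizationMk_eq p

theorem mk_map {n m : SimplexCategory} (f : m ⟶ n) (σ : (nerve (RightGroupoid G)).obj (op n))
    (t : _root_.stdSimplex ℝ (Fin (m.len + 1))) :
    mk ((nerve (RightGroupoid G)).map f.op σ) t = mk σ (_root_.stdSimplex.map f t) :=
  realizationMk_map f σ t

theorem smul_mk (h : G) {n : SimplexCategory}
    (σ : (nerve (RightGroupoid G)).obj (op n)) (t : _root_.stdSimplex ℝ (Fin (n.len + 1))) :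
    h • mk σ t =
      mk ((nerveMap (RightGroupoid.translate h)).app (op n) σ) t :=
  toTop_map_realizationMk _ _ _

theorem toBG_mk {n : SimplexCategory}
    (σ : (nerve (RightGroupoid G)).obj (op n)) (t : _root_.stdSimplex ℝ (Fin (n.len + 1))) :
    toBG G (mk σ t) =
      (realizationMk ((RightGroupoid.nerveProj G).app (op n) σ) t : BG G) :=
  toTop_map_realizationMk _ _ _

instance : ContinuousConstSMul G (BrG G) where
  continuous_const_smul h :=
    (SSet.toTop.map (nerveMap (RightGroupoid.translate h))).hom.continuous

theorem toBG_smul (h : G) (p : BrG G) : toBG G (h • p) = toBG G p := by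
  obtain ⟨n, σ, t, rfl⟩ := exists_mk_eq p
  rw [smul_mk, toBG_mk, toBG_mk]
  rfl

variable (G) in
/-- The map from the orbit space of `Br𝒢` to `BG` induced by the projection. -/
noncomputable def orbitToBG : C(MulAction.orbitRel.Quotient G (BrG G), BG G) where
  toFun := Quotient.lift (toBG G) (by rintro _ p ⟨h, rfl⟩; exact toBG_smul h p)
  continuous_toFun := (toBG G).continuous.quotient_lift _

variable (G) in
/-- The quotient map onto the orbit space of `Br𝒢`. -/
noncomputable def toOrbit : C(BrG G, MulAction.orbitRel.Quotient G (BrG G)) :=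
  ⟨Quotient.mk _, continuous_quotient_mk'⟩

theorem toOrbit_smul (h : G) (p : BrG G) : toOrbit G (h • p) = toOrbit G p :=
  Quotient.sound ⟨h, rfl⟩

theorem toOrbit_mk_eq {n : SimplexCategory}
    {σ σ' : (nerve (RightGroupoid G)).obj (op n)}
    (hσ : (RightGroupoid.nerveProj G).app (op n) σ = (RightGroupoid.nerveProj G).app (op n) σ')
    (t : _root_.stdSimplex ℝ (Fin (n.len + 1))) :
    toOrbit G (mk σ t) = toOrbit G (mk σ' t) := by
  obtain ⟨h, rfl⟩ := RightGroupoid.exists_translate_of_nerveProj_eq hσ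
  rw [← smul_mk, toOrbit_smul]

variable (G) in
/-- The simplicial map that induces the inverse of `orbitToBG`. -/
noncomputable def nerveToOrbit : nerve (SingleObj G) ⟶
    TopCat.toSSet.obj (TopCat.of (MulAction.orbitRel.Quotient G (BrG G))) where
  app n := ↾fun τ ↦ (TopCat.toSSetObjEquiv _ n).symm <|
    (toOrbit G).comp
      (mk (n := n.unop) (RightGroupoid.nerveProj_surjective n.unop τ).choose)
  naturality n m f := by
    ext τ
    apply (TopCat.toSSetObjEquiv _ m).injective
    ext t
    -- The chosen lifts need not commute with faces and degeneracies, but two lifts of one simplex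
    -- are translates, so they agree in the orbit space.
    have h1 := (RightGroupoid.nerveProj_surjective n.unop τ).choose_spec
    have h2 := (RightGroupoid.nerveProj_surjective m.unop
      ((nerve (SingleObj G)).map f τ)).choose_spec
    have h3 := NatTrans.naturality_apply (RightGroupoid.nerveProj G) f
      (RightGroupoid.nerveProj_surjective n.unop τ).choose
    refine (toOrbit_mk_eq (h2.trans ((h3.trans ?_).symm)) t).trans
      (congrArg (toOrbit G) (mk_map f.unop _ t))
    exact congrArg ((nerve (SingleObj G)).map f) h1

theorem nerveToOrbit_desc_mk {n : SimplexCategory}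
    (σ : (nerve (RightGroupoid G)).obj (op n)) (t : _root_.stdSimplex ℝ (Fin (n.len + 1))) :
    realizationDesc (nerveToOrbit G)
        (realizationMk ((RightGroupoid.nerveProj G).app (op n) σ) t) =
      toOrbit G (mk σ t) := by
  rw [realizationDesc_mk]
  exact toOrbit_mk_eq (RightGroupoid.nerveProj_surjective n _).choose_spec t

variable (G) in
/-- The orbit space of `Br𝒢` is homeomorphic to `BG`. -/
noncomputable def orbitHomeo : MulAction.orbitRel.Quotient G (BrG G) ≃ₜ BG G where
  toFun := orbitToBG G
  invFun := realizationDesc (nerveToOrbit G)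
  left_inv p := by
    obtain ⟨p, rfl⟩ := Quotient.exists_rep p
    obtain ⟨n, σ, t, rfl⟩ := exists_mk_eq p
    exact (congrArg (realizationDesc (nerveToOrbit G)) (toBG_mk σ t)).trans
      (nerveToOrbit_desc_mk σ t)
  right_inv p := by
    obtain ⟨n, τ, t, rfl⟩ := exists_realizationMk_eq p
    obtain ⟨σ, rfl⟩ := RightGroupoid.nerveProj_surjective n τ
    exact (congrArg (orbitToBG G) (nerveToOrbit_desc_mk σ t)).trans (toBG_mk σ t)
  continuous_toFun := (orbitToBG G).continuous
  continuous_invFun := (realizationDesc (nerveToOrbit G)).continuous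

theorem orbitHomeo_mk (p : BrG G) : orbitHomeo G (Quotient.mk _ p) = toBG G p := rfl

end BrG

/-! ### Lengths of subdivision intervals inside [a, b]. -/

section IntervalWeights

/-- Given a subdivision of `[0, 1]` into consecutive intervals of lengths `t i`, the length of the
part of the `i`-th interval that lies in `[a, b]`. -/
noncomputable def intervalWeight (a b : ℝ) {m : ℕ} (t : Fin m → ℝ) (i : Fin m) : ℝ :=
  max a (min b (∑ j ∈ Finset.Iic i, t j)) - max a (min b (∑ j ∈ Finset.Iio i, t j))

/-- The sum telescopes: a nonempty lower set is `Iic` of its maximum, and removing the maximum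
leaves `Iio`. -/
theorem sum_intervalWeight_of_isLowerSet (a b : ℝ) {m : ℕ} (t : Fin m → ℝ) (D : Finset (Fin m))
    (hD : IsLowerSet (D : Set (Fin m))) :
    ∑ i ∈ D, intervalWeight a b t i = max a (min b (∑ i ∈ D, t i)) - max a (min b 0) := by
  classical
  induction hk : D.card generalizing D with
  | zero =>
    obtain rfl := Finset.card_eq_zero.mp hk
    simp
  | succ k ih =>
    have hne : D.Nonempty := Finset.card_pos.mp (by omega)
    set x := D.max' hne with hx
    have hxD : x ∈ D := D.max'_mem hne
    have hIic : D = Finset.Iic x := by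
      ext j
      rw [Finset.mem_Iic]
      exact ⟨fun hj ↦ D.le_max' j hj, fun hj ↦ hD hj hxD⟩
    have hIio : D.erase x = Finset.Iio x := by
      rw [hIic]
      ext j
      simp [lt_iff_le_and_ne, and_comm]
    have hE := ih (D.erase x) (by rw [hIio, Finset.coe_Iio]; exact isLowerSet_Iio x)
      (by rw [Finset.card_erase_of_mem hxD]; omega)
    rw [← Finset.add_sum_erase D _ hxD, hE, hIio]
    conv_rhs => rw [hIic]
    rw [intervalWeight]
    ring

theorem intervalWeight_nonneg (a b : ℝ) {m : ℕ} {t : Fin m → ℝ} (ht : ∀ i, 0 ≤ t i) (i : Fin m) :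
    0 ≤ intervalWeight a b t i := by
  refine sub_nonneg.mpr (max_le_max le_rfl (min_le_min le_rfl ?_))
  exact Finset.sum_le_sum_of_subset_of_nonneg
    (fun j hj ↦ Finset.mem_Iic.mpr (Finset.mem_Iio.mp hj).le) fun j _ _ ↦ ht j

/-- This compatibility with simplicial operators makes the weights descend to the realization. By
monotonicity the preimages of `Iic i` and `Iio i` are lower sets, and the fibre over i is their
difference. -/
theorem intervalWeight_map (a b : ℝ) {m n : ℕ} (f : Fin m → Fin n) (hf : Monotone f)
    (t : stdSimplex ℝ (Fin m)) (i : Fin n) :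
    intervalWeight a b (stdSimplex.map f t) i =
      ∑ j with f j = i, intervalWeight a b t j := by
  classical
  have hsum (D : Finset (Fin n)) :
      ∑ j ∈ D, stdSimplex.map f t j = ∑ k with f k ∈ D, t k := by
    simp only [stdSimplex.map_coe, FunOnFinite.linearMap_apply_apply]
    rw [← Finset.sum_fiberwise_of_maps_to (s := {k | f k ∈ D}) (t := D) (g := f)
      (fun k hk ↦ by simpa using hk)]
    refine Finset.sum_congr rfl fun j hj ↦ Finset.sum_congr ?_ fun _ _ ↦ rfl
    ext k
    simp only [Finset.mem_filter, Finset.mem_univ, true_and]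
    exact ⟨fun h ↦ ⟨h ▸ hj, h⟩, fun h ↦ h.2⟩
  have h1 := sum_intervalWeight_of_isLowerSet a b t {k | f k ∈ Finset.Iic i} (by
    intro x y hyx hx
    simp only [Finset.mem_Iic, Finset.coe_filter, Finset.mem_univ, true_and] at hx ⊢
    exact (hf hyx).trans hx)
  have h2 := sum_intervalWeight_of_isLowerSet a b t {k | f k ∈ Finset.Iio i} (by
    intro x y hyx hx
    simp only [Finset.mem_Iio, Finset.coe_filter, Finset.mem_univ, true_and] at hx ⊢
    exact (hf hyx).trans_lt hx)
  have h3 : ∑ k with f k ∈ Finset.Iic i, intervalWeight a b t k =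
      ∑ k with f k ∈ Finset.Iio i, intervalWeight a b t k +
        ∑ k with f k = i, intervalWeight a b t k := by
    rw [← Finset.sum_union]
    · congr 1
      ext k
      simp [le_iff_lt_or_eq]
    · rw [Finset.disjoint_left]
      intro k hk hk'
      simp only [Finset.mem_Iio, Finset.mem_filter, Finset.mem_univ, true_and] at hk hk'
      exact hk.ne hk'
  rw [intervalWeight, hsum, hsum]
  linarith

@[fun_prop]
theorem continuous_intervalWeight (a b : ℝ) {m : ℕ} (i : Fin m) :
    Continuous fun t : Fin m → ℝ ↦ intervalWeight a b t i := by
  unfold intervalWeight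
  fun_prop

end IntervalWeights

/-! ### The covering Br𝒢 → BG. -/

namespace BrG

open SSet

variable {G : Type u} [Group G]

open Classical in
/-- The simplicial map that induces `weight a b g`. -/
noncomputable def nerveWeight (a b : ℝ) (g : G) :
    nerve (RightGroupoid G) ⟶ TopCat.toSSet.obj (TopCat.of (ULift.{u} ℝ)) where
  app n := ↾fun σ ↦ (TopCat.toSSetObjEquiv _ n).symm
    ⟨fun t ↦ ⟨∑ i with RightGroupoid.nerveEquivFun n.unop σ i = g, intervalWeight a b t i⟩, by
      refine continuous_uliftUp.comp (continuous_finsetSum _ fun i _ ↦ ?_)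
      exact (continuous_intervalWeight a b i).comp continuous_subtype_val⟩
  naturality n m f := by
    ext σ
    apply (TopCat.toSSetObjEquiv _ m).injective
    ext t
    change ∑ j with RightGroupoid.nerveEquivFun n.unop σ (f.unop j) = g, intervalWeight a b t j =
      ∑ i with RightGroupoid.nerveEquivFun n.unop σ i = g,
        intervalWeight a b (_root_.stdSimplex.map f.unop t) i
    rw [← Finset.sum_fiberwise_of_maps_to
      (t := {i | RightGroupoid.nerveEquivFun n.unop σ i = g}) (g := f.unop)
      (fun k hk ↦ by simpa using hk)]
    refine Finset.sum_congr rfl fun i hi ↦ ?_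
    rw [intervalWeight_map a b f.unop f.unop.toOrderHom.monotone]
    refine Finset.sum_congr ?_ fun _ _ ↦ rfl
    ext k
    simp only [Finset.mem_filter, Finset.mem_univ, true_and] at hi ⊢
    exact ⟨fun h ↦ h.2, fun h ↦ ⟨h ▸ hi, h⟩⟩

/-- A point of `Br𝒢` in the simplex with vertices `g₀, …, gₙ` and with barycentric coordinates
`t₀, …, tₙ` gives the step function on `[0, 1]` with the value `gᵢ` on the `i`-th of the
consecutive intervals of lengths `t₀, …, tₙ`; this is the length of the part of `[a, b]` where this
step function has the value `g`. -/
noncomputable def weight (a b : ℝ) (g : G) (p : BrG G) : ℝ :=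
  (realizationDesc (nerveWeight a b g) p).down

theorem continuous_weight (a b : ℝ) (g : G) : Continuous (weight a b g) :=
  continuous_uliftDown.comp (realizationDesc (nerveWeight a b g)).continuous

open Classical in
theorem weight_mk (a b : ℝ) (g : G) {n : SimplexCategory}
    (σ : (nerve (RightGroupoid G)).obj (op n)) (t : _root_.stdSimplex ℝ (Fin (n.len + 1))) :
    weight a b g (mk σ t) =
      ∑ i with RightGroupoid.nerveEquivFun n σ i = g, intervalWeight a b t i :=
  congrArg ULift.down (realizationDesc_mk (nerveWeight a b g) σ t)

theorem weight_smul (a b : ℝ) (g h : G) (p : BrG G) :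
    weight a b (h * g) (h • p) = weight a b g p := by
  classical
  obtain ⟨n, σ, t, rfl⟩ := exists_mk_eq p
  rw [smul_mk, weight_mk, weight_mk]
  refine Finset.sum_congr (Finset.ext fun i ↦ ?_) fun _ _ ↦ rfl
  rw [Finset.mem_filter, Finset.mem_filter, RightGroupoid.nerveEquivFun_translate, mul_right_inj]

theorem weight_add_le {a b : ℝ} (hab : a ≤ b) {g g' : G} (hg : g ≠ g') (p : BrG G) :
    weight a b g p + weight a b g' p ≤ b - a := by
  classical
  obtain ⟨n, σ, t, rfl⟩ := exists_mk_eq p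
  rw [weight_mk, weight_mk, ← Finset.sum_union]
  · refine (Finset.sum_le_sum_of_subset_of_nonneg (Finset.subset_univ _)
      fun i _ _ ↦ intervalWeight_nonneg a b t.2.1 i).trans ?_
    rw [sum_intervalWeight_of_isLowerSet _ _ _ _ (by simp [isLowerSet_univ])]
    exact sub_le_sub (max_le hab (min_le_left _ _)) (le_max_left _ _)
  · rw [Finset.disjoint_left]
    intro i hi hi'
    simp only [Finset.mem_filter, Finset.mem_univ, true_and] at hi hi'
    exact hg (hi.symm.trans hi')

theorem exists_lt_weight (p : BrG G) : ∃ a b, a < b ∧ ∃ g, (b - a) / 2 < weight a b g p := by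
  classical
  obtain ⟨n, σ, t, rfl⟩ := exists_mk_eq p
  obtain ⟨i, hi⟩ : ∃ i, 0 < t i := by
    by_contra! h
    have := Finset.sum_nonpos fun i (_ : i ∈ Finset.univ) ↦ h i
    rw [_root_.stdSimplex.sum_eq_one] at this
    linarith
  have hsum : ∑ j ∈ Finset.Iic i, t j = t i + ∑ j ∈ Finset.Iio i, t j := by
    rw [← Finset.Iio_insert, Finset.sum_insert (by simp)]
  have hab : ∑ j ∈ Finset.Iio i, t j < ∑ j ∈ Finset.Iic i, t j := by linarith
  -- With [a, b] the i-th interval itself, the step function is constant there, so the weight is at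
  -- least b - a.
  refine ⟨∑ j ∈ Finset.Iio i, t j, ∑ j ∈ Finset.Iic i, t j, hab,
    RightGroupoid.nerveEquivFun n σ i, ?_⟩
  rw [weight_mk]
  refine lt_of_lt_of_le ?_ (Finset.single_le_sum
    (fun j _ ↦ intervalWeight_nonneg _ _ t.2.1 j) (Finset.mem_filter.mpr ⟨Finset.mem_univ i, rfl⟩))
  change _ < max _ (min _ (∑ j ∈ Finset.Iic i, t j)) - max _ (min _ (∑ j ∈ Finset.Iio i, t j))
  rw [min_self, min_eq_right hab.le, max_self, max_eq_right hab.le]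
  linarith

variable (G) in
theorem isQuotientCoveringMap_toBG : IsQuotientCoveringMap (toBG G) G where
  toIsQuotientMap := (orbitHomeo G).isQuotientMap.comp isQuotientMap_quotient_mk'
  toContinuousConstSMul := inferInstance
  apply_eq_iff_mem_orbit {p q} := by
    rw [← orbitHomeo_mk, ← orbitHomeo_mk, (orbitHomeo G).injective.eq_iff]
    exact Quotient.eq''
  disjoint p := by
    obtain ⟨a, b, hab, g, hg⟩ := exists_lt_weight p
    refine ⟨{q | (b - a) / 2 < weight a b g q},
      (isOpen_lt continuous_const (continuous_weight a b g)).mem_nhds hg, ?_⟩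
    rintro h ⟨_, ⟨q, hq, rfl⟩, hq'⟩
    by_contra hh
    -- At h • q both values h * g and g would fill more than half of [a, b].
    have h1 := weight_add_le hab.le (g := h * g) (g' := g) (by simpa using hh) (h • q)
    rw [weight_smul] at h1
    simp only [Set.mem_ofPred_eq] at hq hq'
    linarith

end BrG

/-! ### Cones and the contraction of Br𝒢. -/

namespace SimplexCategory

/-- The extension of `f : m ⟶ n` to a morphism that preserves a new initial vertex. -/
def coneMap {m n : SimplexCategory} (f : m ⟶ n) : ⦋m.len + 1⦌ ⟶ ⦋n.len + 1⦌ :=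
  Hom.mk
    { toFun := Fin.cons 0 fun i ↦ (f i).succ
      monotone' := by
        intro i j hij
        induction i using Fin.cases with
        | zero => simp
        | succ i =>
          induction j using Fin.cases with
          | zero => simp at hij
          | succ j =>
            exact Fin.succ_le_succ_iff.mpr
              (f.toOrderHom.monotone (Fin.succ_le_succ_iff.mp hij)) }

theorem coneMap_zero {m n : SimplexCategory} (f : m ⟶ n) : coneMap f 0 = 0 := rfl

theorem coneMap_succ {m n : SimplexCategory} (f : m ⟶ n) (i : Fin (m.len + 1)) :
    coneMap f i.succ = (f i).succ := rfl

/-- The face opposite to a new initial vertex. -/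
def coneFace (n : SimplexCategory) : n ⟶ ⦋n.len + 1⦌ :=
  Hom.mk (Fin.succOrderEmb (n.len + 1)).toOrderHom

end SimplexCategory

namespace stdSimplex

/-- The point that divides the segment from a new initial vertex to `t` in the ratio `1 - s : s`. -/
def cone {m : ℕ} (t : stdSimplex ℝ (Fin m)) (s : unitInterval) : stdSimplex ℝ (Fin (m + 1)) :=
  ⟨Fin.cons (s : ℝ) fun i ↦ (1 - s) * t i, by
    intro i
    induction i using Fin.cases with
    | zero => exact s.2.1
    | succ i => exact mul_nonneg (sub_nonneg.mpr s.2.2) (t.2.1 i), by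
    rw [Fin.sum_univ_succ]
    simp [← Finset.mul_sum]⟩

theorem cone_apply_zero {m : ℕ} (t : stdSimplex ℝ (Fin m)) (s : unitInterval) :
    cone t s 0 = s := rfl

theorem cone_apply_succ {m : ℕ} (t : stdSimplex ℝ (Fin m)) (s : unitInterval) (i : Fin m) :
    cone t s i.succ = (1 - s) * t i := rfl

theorem continuous_cone {m : ℕ} :
    Continuous fun x : stdSimplex ℝ (Fin m) × unitInterval ↦ cone x.1 x.2 := by
  refine Continuous.subtype_mk (continuous_pi fun i ↦ ?_) _
  induction i using Fin.cases with
  | zero => exact continuous_subtype_val.comp continuous_snd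
  | succ i =>
    exact (continuous_const.sub (continuous_subtype_val.comp continuous_snd)).mul
      ((continuous_apply i).comp (continuous_subtype_val.comp continuous_fst))

theorem map_apply_eq_sum {m n : ℕ} (f : Fin m → Fin n) (t : stdSimplex ℝ (Fin m)) (i : Fin n) :
    map f t i = ∑ j, if f j = i then t j else 0 := by
  rw [map_coe, FunOnFinite.linearMap_apply_apply, Finset.sum_filter]

theorem map_coneMap {m n : SimplexCategory} (f : m ⟶ n) (t : stdSimplex ℝ (Fin (m.len + 1)))
    (s : unitInterval) : map (SimplexCategory.coneMap f) (cone t s) = cone (map f t) s := by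
  refine stdSimplex.ext (funext fun i ↦ ?_)
  refine (map_apply_eq_sum (m := m.len + 2) (n := n.len + 2) _ (cone t s) i).trans ?_
  rw [Fin.sum_univ_succ]
  induction i using Fin.cases with
  | zero =>
    simp [cone_apply_zero, SimplexCategory.coneMap_zero, SimplexCategory.coneMap_succ]
  | succ i =>
    rw [cone_apply_succ, map_apply_eq_sum, Finset.mul_sum]
    simp only [cone_apply_succ, SimplexCategory.coneMap_zero, SimplexCategory.coneMap_succ,
      Fin.succ_inj, mul_ite, mul_zero, (Fin.succ_ne_zero i).symm, if_false, zero_add]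

theorem cone_zero {m : ℕ} (t : stdSimplex ℝ (Fin m)) : cone t 0 = map Fin.succ t := by
  refine stdSimplex.ext (funext fun i ↦ ?_)
  rw [map_apply_eq_sum]
  induction i using Fin.cases with
  | zero => simp [cone_apply_zero]
  | succ i => simp [cone_apply_succ]

theorem cone_one {m : ℕ} (t : stdSimplex ℝ (Fin m)) : cone t 1 = vertex 0 := by
  refine stdSimplex.ext (funext fun i ↦ ?_)
  induction i using Fin.cases with
  | zero => simp [cone_apply_zero]
  | succ i => simp [cone_apply_succ]

end stdSimplex

namespace BrG

open SSet

variable {G : Type u} [Group G]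

/-- The simplex with initial vertex `1` and with opposite face `σ`. -/
def coneSimplex {n : SimplexCategory} (σ : (nerve (RightGroupoid G)).obj (op n)) :
    (nerve (RightGroupoid G)).obj (op ⦋n.len + 1⦌) :=
  (RightGroupoid.nerveEquivFun ⦋n.len + 1⦌).symm
    (Fin.cons 1 (RightGroupoid.nerveEquivFun n σ))

theorem coneSimplex_map {m n : SimplexCategory} (f : m ⟶ n)
    (σ : (nerve (RightGroupoid G)).obj (op n)) :
    coneSimplex ((nerve (RightGroupoid G)).map f.op σ) =
      (nerve (RightGroupoid G)).map (SimplexCategory.coneMap f).op (coneSimplex σ) := by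
  apply (RightGroupoid.nerveEquivFun _).injective
  rw [RightGroupoid.nerveEquivFun_map]
  simp only [coneSimplex, Equiv.apply_symm_apply]
  funext i
  induction i using Fin.cases with
  | zero => rfl
  | succ i => rfl

theorem map_coneFace_coneSimplex {n : SimplexCategory} (σ : (nerve (RightGroupoid G)).obj (op n)) :
    (nerve (RightGroupoid G)).map (SimplexCategory.coneFace n).op (coneSimplex σ) = σ :=
  (RightGroupoid.nerveEquivFun _).injective rfl

variable (G) in
/-- The vertex `1` of `r𝒢`. -/
def oneVertex : (nerve (RightGroupoid G)).obj (op ⦋0⦌) :=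
  (RightGroupoid.nerveEquivFun ⦋0⦌).symm fun _ ↦ 1

theorem map_coneSimplex_zero {n : SimplexCategory} (σ : (nerve (RightGroupoid G)).obj (op n)) :
    (nerve (RightGroupoid G)).map
      (SimplexCategory.const ⦋0⦌ ⦋n.len + 1⦌ 0).op (coneSimplex σ) = oneVertex G :=
  (RightGroupoid.nerveEquivFun _).injective rfl

variable (G) in
/-- The simplicial map that induces the contraction of `Br𝒢`. -/
noncomputable def nerveContraction : nerve (RightGroupoid G) ⟶
    TopCat.toSSet.obj (TopCat.of C(unitInterval, BrG G)) where
  app n := ↾fun σ ↦ (TopCat.toSSetObjEquiv _ n).symm <|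
    -- Taking values in the path space lets the universal property of the realization produce the
    -- whole homotopy, with no need to realize a product with the interval.
    ContinuousMap.curry ((mk (coneSimplex (n := n.unop) σ)).comp
      ⟨fun x ↦ stdSimplex.cone x.1 x.2, stdSimplex.continuous_cone⟩)
  naturality n m f := by
    ext σ
    apply (TopCat.toSSetObjEquiv _ m).injective
    ext t s
    change mk (coneSimplex ((nerve (RightGroupoid G)).map f.unop.op σ)) (stdSimplex.cone t s) =
      mk (coneSimplex (n := n.unop) σ) (stdSimplex.cone (stdSimplex.map f.unop t) s)
    rw [coneSimplex_map, mk_map, stdSimplex.map_coneMap]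

variable (G) in
/-- The contraction of `Br𝒢` to the vertex `1`. -/
noncomputable def contraction : C(BrG G, C(unitInterval, BrG G)) :=
  realizationDesc (nerveContraction G)

theorem contraction_mk {n : SimplexCategory} (σ : (nerve (RightGroupoid G)).obj (op n))
    (t : _root_.stdSimplex ℝ (Fin (n.len + 1))) (s : unitInterval) :
    contraction G (mk σ t) s = mk (coneSimplex σ) (stdSimplex.cone t s) :=
  DFunLike.congr_fun (realizationDesc_mk (nerveContraction G) σ t) s

theorem contraction_zero (p : BrG G) : contraction G p 0 = p := by
  obtain ⟨n, σ, t, rfl⟩ := exists_mk_eq p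
  rw [contraction_mk, stdSimplex.cone_zero]
  conv_rhs => rw [← map_coneFace_coneSimplex σ, mk_map]
  rfl

theorem contraction_one (p : BrG G) :
    contraction G p 1 = mk (oneVertex G) (stdSimplex.vertex 0) := by
  obtain ⟨n, σ, t, rfl⟩ := exists_mk_eq p
  rw [contraction_mk, stdSimplex.cone_one, ← map_coneSimplex_zero σ, mk_map,
    stdSimplex.map_vertex]
  rfl

instance : ContractibleSpace (BrG G) := by
  rw [contractible_iff_id_nullhomotopic]
  exact ⟨mk (oneVertex G) (stdSimplex.vertex 0), ⟨{
    toFun := fun x ↦ contraction G x.2 x.1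
    continuous_toFun := by fun_prop
    map_zero_left := contraction_zero
    map_one_left := contraction_one }⟩⟩

end BrG

end ClassifyingSpace

/-! ### Higher homotopy groups under coverings. -/

section CoveringHomotopy

open scoped Topology.Homotopy unitInterval

namespace GenLoop

variable {N : Type*}

/-- A function on the cube that vanishes on the boundary and is `1` away from it. -/
noncomputable def bump [Fintype N] (y : N → I) : I :=
  ∏ i, Set.projIcc (0 : ℝ) 1 zero_le_one (min (4 * (y i : ℝ)) (4 * (1 - y i)))

/-- An expansion of the cube about its center, followed by the retraction onto the cube. -/
noncomputable def expand (s : I) (y : N → I) : N → I := fun i ↦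
  Set.projIcc (0 : ℝ) 1 zero_le_one (y i + s * (y i - 1 / 2))

@[fun_prop]
theorem continuous_bump [Fintype N] : Continuous (bump (N := N)) := by
  unfold bump
  exact continuous_finsetProd _ fun i _ ↦ continuous_projIcc.comp (by fun_prop)

theorem continuous_expand : Continuous fun x : I × (N → I) ↦ expand x.1 x.2 :=
  continuous_pi fun i ↦ continuous_projIcc.comp (by fun_prop)

theorem bump_eq_zero [Fintype N] {y : N → I} (hy : y ∈ Cube.boundary N) : bump y = 0 := by
  obtain ⟨i, hi⟩ := hy
  refine Finset.prod_eq_zero (Finset.mem_univ i) (Set.projIcc_of_le_left _ ?_)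
  obtain hi | hi := hi <;> simp [hi]

theorem expand_zero (y : N → I) : expand 0 y = y := by
  funext i
  simp [expand]

theorem expand_mem_boundary (s : I) {y : N → I} (hy : y ∈ Cube.boundary N) :
    expand s y ∈ Cube.boundary N := by
  obtain ⟨i, hi⟩ := hy
  have hs : (0 : ℝ) ≤ s := s.2.1
  refine ⟨i, hi.imp (fun h ↦ Set.projIcc_of_le_left _ ?_) fun h ↦ Set.projIcc_of_right_le _ ?_⟩
  · simp [h, hs]
  · simp only [h, Set.Icc.coe_one]
    linarith

/-- The constants match: `bump y ≠ 1` puts some coordinate below 1/4 or above 3/4, and doubling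
about 1/2 sends it to or past an end of [0, 1]. -/
theorem expand_one_mem_boundary [Fintype N] {y : N → I} (hy : bump y ≠ 1) :
    expand 1 y ∈ Cube.boundary N := by
  obtain ⟨i, hi⟩ : ∃ i, Set.projIcc (0 : ℝ) 1 zero_le_one
      (min (4 * (y i : ℝ)) (4 * (1 - y i))) ≠ 1 := by
    by_contra! h
    exact hy (Finset.prod_eq_one fun i _ ↦ h i)
  have h : min (4 * (y i : ℝ)) (4 * (1 - y i)) < 1 := by
    by_contra! h
    exact hi (Set.projIcc_of_right_le _ h)
  refine ⟨i, (min_lt_iff.mp h).imp (fun h ↦ Set.projIcc_of_le_left _ ?_)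
    fun h ↦ Set.projIcc_of_right_le _ ?_⟩ <;>
  · simp only [Set.Icc.coe_one]
    linarith

variable {X : Type*} [TopologicalSpace X]

/-- In a contractible space every generalized loop is null-homotopic. -/
theorem homotopic_const_of_contractible [Finite N] [ContractibleSpace X] {x : X}
    (f : Ω^ N X x) : GenLoop.Homotopic f GenLoop.const := by
  have := Fintype.ofFinite N
  obtain ⟨v, ⟨H⟩⟩ := id_nullhomotopic X
  have hf : ∀ y ∈ Cube.boundary N, f y = x := f.2
  let g : C(N → I, X) := ⟨fun y ↦ H (bump y, x), by fun_prop⟩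
  -- A free contraction H moves the base point, so it is damped by `bump` near the boundary.
  -- Expansion ensures that at the end each point either has been contracted fully or comes from f =
  -- x, which leaves only the track of x.
  have h1 : ContinuousMap.HomotopicRel f.1 g (Cube.boundary N) := ⟨
    { toFun := fun z ↦ H (z.1 * bump z.2, f (expand z.1 z.2))
      continuous_toFun := H.continuous.comp ((continuous_fst.mul
        (continuous_bump.comp continuous_snd)).prodMk (f.1.continuous.comp continuous_expand))
      map_zero_left := fun y ↦ by simp [expand_zero]
      map_one_left := fun y ↦ by
        by_cases hy : bump y = 1
        · simp [g, hy]
        · simp [g, hf _ (expand_one_mem_boundary hy)]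
      prop' := fun s y hy ↦ by
        simp [bump_eq_zero hy, hf _ hy, hf _ (expand_mem_boundary s hy)] }⟩
  -- The track of x is retraced back to x.
  have h2 : ContinuousMap.HomotopicRel g (GenLoop.const : Ω^ N X x).1 (Cube.boundary N) := ⟨
    { toFun := fun z ↦ H (σ z.1 * bump z.2, x)
      continuous_toFun := by fun_prop
      map_zero_left := fun y ↦ by simp [g]
      map_one_left := fun y ↦ by simp
      prop' := fun s y hy ↦ by simp [g, bump_eq_zero hy] }⟩
  exact h1.trans h2

end GenLoop

namespace IsCoveringMap

variable {E X : Type*} [TopologicalSpace E] [TopologicalSpace X] {p : E → X}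

/-- A map from the boundary of the cube that lifts a constant map is constant. -/
theorem eq_zero_of_mem_boundary (hp : IsCoveringMap p) {N : Type*} [Nontrivial N]
    (F : C(N → I, E)) {x : X} (hF : ∀ y ∈ Cube.boundary N, p (F y) = x)
    {y : N → I} (hy : y ∈ Cube.boundary N) : F y = F 0 := by
  classical
  have key (γ : C(I, N → I)) (hγ : ∀ s, γ s ∈ Cube.boundary N) : F (γ 0) = F (γ 1) :=
    hp.const_of_comp (g := F ∘ γ) (by fun_prop)
      (fun a a' ↦ (hF _ (hγ a)).trans (hF _ (hγ a')).symm) 0 1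
  obtain ⟨i, hi⟩ := hy
  obtain ⟨j, hj⟩ := exists_ne i
  -- Two boundary paths from y to 0: γ shrinks all coordinates but i inside the face containing y,
  -- then γ' shrinks coordinate i inside the face where coordinate j is 0. A lift of a constant path
  -- is constant.
  let γ : C(I, N → I) := ⟨fun s k ↦ if k = i then y i else σ s * y k, by
    refine continuous_pi fun k ↦ ?_
    split_ifs <;> fun_prop⟩
  let γ' : C(I, N → I) := ⟨fun s k ↦ if k = i then σ s * y i else 0, by
    refine continuous_pi fun k ↦ ?_
    split_ifs <;> fun_prop⟩
  have h1 := key γ fun s ↦ ⟨i, by simpa [γ] using hi⟩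
  have h2 := key γ' fun s ↦ ⟨j, Or.inl (by simp [γ', hj])⟩
  have e1 : γ 0 = y := by
    funext k
    by_cases hk : k = i <;> simp [γ, hk]
  have e2 : γ 1 = γ' 0 := by
    funext k
    by_cases hk : k = i <;> simp [γ, γ', hk]
  have e3 : γ' 1 = 0 := by
    funext k
    by_cases hk : k = i <;> simp [γ', hk]
  rw [← e1, h1, e2, h2, e3]

/-- The retraction of ℝᴺ onto the cube extends f to a simply connected, locally path connected
space; the lift found there is restricted to the cube. -/
theorem exists_lift_cube (hp : IsCoveringMap p) {N : Type*} [Finite N] (f : C(N → I, X)) (e : E)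
    (he : p e = f 0) : ∃ F : C(N → I, E), F 0 = e ∧ ∀ y, p (F y) = f y := by
  let r : C(N → ℝ, N → I) := ⟨fun y i ↦ Set.projIcc (0 : ℝ) 1 zero_le_one (y i),
    continuous_pi fun i ↦ continuous_projIcc.comp (continuous_apply i)⟩
  let j : C(N → I, N → ℝ) := ⟨fun y i ↦ y i, by fun_prop⟩
  have hrj (y : N → I) : r (j y) = y := funext fun i ↦ Set.projIcc_val zero_le_one (y i)
  obtain ⟨F, ⟨hF0, hF⟩, -⟩ := hp.existsUnique_continuousMap_lifts (f.comp r) (j 0) e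
    (by rw [he, ContinuousMap.comp_apply, hrj])
  refine ⟨F.comp j, hF0, fun y ↦ ?_⟩
  refine (congrFun hF (j y)).trans ?_
  rw [ContinuousMap.comp_apply, hrj]

/-- The higher homotopy groups of the base of a covering with contractible total space vanish. -/
theorem subsingleton_homotopyGroup (hp : IsCoveringMap p) [ContractibleSpace E]
    (hs : Function.Surjective p) (N : Type*) [Finite N] [Nontrivial N] (x : X) :
    Subsingleton (HomotopyGroup N X x) := by
  classical
  refine subsingleton_of_forall_eq (Quotient.mk _ GenLoop.const) fun q ↦ ?_
  obtain ⟨f, rfl⟩ := Quotient.exists_rep q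
  apply Quotient.sound
  have hf : ∀ y ∈ Cube.boundary N, f y = x := f.2
  have h0 : (0 : N → I) ∈ Cube.boundary N := ⟨Classical.arbitrary N, Or.inl rfl⟩
  obtain ⟨e, he⟩ := hs x
  obtain ⟨F, hF0, hF⟩ := hp.exists_lift_cube f.1 e (he.trans (hf 0 h0).symm)
  let F' : Ω^ N E e := ⟨F, fun y hy ↦
    (hp.eq_zero_of_mem_boundary F (fun z hz ↦ (hF z).trans (hf z hz)) hy).trans hF0⟩
  have h := (GenLoop.homotopic_const_of_contractible F').comp_continuousMap
    (g := ⟨p, hp.continuous⟩)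
  have e1 : (⟨p, hp.continuous⟩ : C(E, X)).comp F'.1 = f.1 := ContinuousMap.ext hF
  have e2 : (⟨p, hp.continuous⟩ : C(E, X)).comp (GenLoop.const : Ω^ N E e).1 =
      (GenLoop.const : Ω^ N X x).1 := ContinuousMap.ext fun _ ↦ he
  rw [e1, e2] at h
  exact h

end IsCoveringMap

end CoveringHomotopy

/-! ### Cell complexes under colimit-preserving functors. -/

section CellComplexMap

open Limits HomotopicalAlgebra

universe w w' t v v' u'

variable {C : Type u} [Category.{v} C] {D : Type u'} [Category.{v'} D]

/-- The image of a cell attachment under a functor that preserves colimits. -/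
noncomputable def HomotopicalAlgebra.AttachCells.mapFunctor {α : Type t} {A B : α → C}
    {g : ∀ a, A a ⟶ B a} {X₁ X₂ : C} {f : X₁ ⟶ X₂} (c : AttachCells.{w} g f) (F : C ⥤ D)
    [PreservesColimitsOfSize.{w, w} F] [PreservesColimitsOfShape WalkingSpan F] :
    AttachCells.{w} (fun a ↦ F.map (g a)) (F.map f) where
  ι := c.ι
  π := c.π
  cofan₁ := Cofan.mk (F.obj c.cofan₁.pt) fun i ↦ F.map (c.cofan₁.inj i)
  cofan₂ := Cofan.mk (F.obj c.cofan₂.pt) fun i ↦ F.map (c.cofan₂.inj i)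
  isColimit₁ := isColimitCofanMkObjOfIsColimit F _ _
    (c.isColimit₁.ofIsoColimit (Cofan.ext (Iso.refl _) (by intro i; simp)))
  isColimit₂ := isColimitCofanMkObjOfIsColimit F _ _
    (c.isColimit₂.ofIsoColimit (Cofan.ext (Iso.refl _) (by intro i; simp)))
  m := F.map c.m
  hm i := (F.map_comp _ _).symm.trans ((congrArg F.map (c.hm i)).trans (F.map_comp _ _))
  g₁ := F.map c.g₁
  g₂ := F.map c.g₂
  isPushout := c.isPushout.map F

/-- The image of a relative cell complex under a functor that preserves colimits and sends the
basic cells to given morphisms, up to isomorphism. -/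
noncomputable def HomotopicalAlgebra.RelativeCellComplex.mapFunctor {A B : ℕ → C} {A' B' : ℕ → D}
    {g : ∀ n, A n ⟶ B n} {g' : ∀ n, A' n ⟶ B' n}
    {X Y : C} {f : X ⟶ Y} (c : RelativeCellComplex.{w} (fun n (_ : Unit) ↦ g n) f) (F : C ⥤ D)
    [PreservesColimitsOfSize.{w, w} F] [PreservesColimitsOfSize.{0, 0} F]
    (e : ∀ n, Arrow.mk (F.map (g n)) ≅ Arrow.mk (g' n))
    {X' Y' : D} {f' : X' ⟶ Y'} (ef : Arrow.mk (F.map f) ≅ Arrow.mk f') :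
    RelativeCellComplex.{w} (fun n (_ : Unit) ↦ g' n) f' :=
  have : PreservesWellOrderContinuousOfShape ℕ F := ⟨fun _ _ ↦ inferInstance⟩
  { toTransfiniteCompositionOfShape := (c.toTransfiniteCompositionOfShape.map F).ofArrowIso ef
    attachCells n hn := ((c.attachCells n hn).mapFunctor F).reindexCellTypes _ id fun _ ↦ e n }

end CellComplexMap

/-! ### The realization of ∂Δⁿ as the boundary of the topological simplex. -/

section BoundaryRealization

open Simplicial Opposite

/-- Each i goes to the largest element of S not above it, or to min S if there is none. -/
theorem exists_monotone_retraction {n : ℕ} (S : Finset (Fin n)) (hS : S.Nonempty) :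
    ∃ θ : Fin n →o Fin n, (∀ i, θ i ∈ S) ∧ ∀ i ∈ S, θ i = i := by
  classical
  have hne (i : Fin n) : (insert (S.min' hS) (S.filter (· ≤ i))).Nonempty :=
    Finset.insert_nonempty _ _
  have hsub (i : Fin n) : insert (S.min' hS) (S.filter (· ≤ i)) ⊆ S :=
    Finset.insert_subset (S.min'_mem hS) (Finset.filter_subset _ _)
  refine ⟨⟨fun i ↦ (insert (S.min' hS) (S.filter (· ≤ i))).max' (hne i), fun i j hij ↦ ?_⟩,
    fun i ↦ hsub i (Finset.max'_mem _ (hne i)), fun i hi ↦ le_antisymm ?_ ?_⟩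
  · exact Finset.max'_subset _ (Finset.insert_subset_insert _ fun k hk ↦
      Finset.mem_filter.mpr ((Finset.mem_filter.mp hk).imp_right fun h ↦ h.trans hij))
  · refine Finset.max'_le _ (hne i) _ fun k hk ↦ ?_
    obtain rfl | hk := Finset.mem_insert.mp hk
    · exact S.min'_le i hi
    · exact (Finset.mem_filter.mp hk).2
  · have hmem : i ∈ insert (S.min' hS) (S.filter (· ≤ i)) :=
      Finset.mem_insert_of_mem (Finset.mem_filter.mpr ⟨hi, le_rfl⟩)
    exact Finset.le_max' _ i hmem

namespace SSet

theorem exists_retraction_support {n : SimplexCategory}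
    (q : _root_.stdSimplex ℝ (Fin (n.len + 1))) :
    ∃ θ : n ⟶ n, (∀ i, q (θ i) ≠ 0) ∧ (∀ i, q i ≠ 0 → θ i = i) ∧
      _root_.stdSimplex.map θ q = q := by
  classical
  have hS : (Finset.univ.filter fun i ↦ q i ≠ 0).Nonempty := by
    by_contra h
    have h0 : ∀ i, q i = 0 := by simpa [Finset.not_nonempty_iff_eq_empty] using h
    simpa [h0] using _root_.stdSimplex.sum_eq_one q
  obtain ⟨θ, h1, h2⟩ := exists_monotone_retraction _ hS
  simp only [Finset.mem_filter, Finset.mem_univ, true_and] at h1 h2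
  refine ⟨SimplexCategory.Hom.mk θ, h1, h2, ?_⟩
  refine _root_.stdSimplex.ext (funext fun i ↦ ?_)
  change _root_.stdSimplex.map θ q i = q i
  have h3 (j : Fin (n.len + 1)) : (if θ j = i then q j else 0) = if j = i then q j else 0 := by
    by_cases hj : q j = 0
    · simp [hj]
    · rw [h2 j hj]
  simp [_root_.stdSimplex.map_apply_eq_sum, h3]

/-- The point of a topological simplex given by a point in the realization of the boundary. -/
noncomputable def boundaryToStdSimplex (n : ℕ) :
    C(|(∂Δ[n] : SSet.{u})|, _root_.stdSimplex ℝ (Fin (n + 1))) :=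
  (⟨_, (SimplexCategory.toTopHomeo.{u} ⦋n⦌).continuous⟩ :
    C(|stdSimplex.obj ⦋n⦌|, _root_.stdSimplex ℝ (Fin (n + 1)))).comp
    (SSet.toTop.map (∂Δ[n] : (Δ[n] : SSet.{u}).Subcomplex).ι).hom

theorem boundaryToStdSimplex_mk {n : ℕ} {m : SimplexCategory}
    (σ : (∂Δ[n] : SSet.{u}).obj (op m)) (t : _root_.stdSimplex ℝ (Fin (m.len + 1))) :
    boundaryToStdSimplex n (realizationMk σ t) =
      _root_.stdSimplex.map (stdSimplex.objEquiv σ.1) t :=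
  (congrArg (SimplexCategory.toTopHomeo ⦋n⦌) (toTop_map_realizationMk _ σ t)).trans
    (toTopHomeo_realizationMk _ t)

theorem mem_boundary_objEquiv_symm_iff {n : ℕ} {m : SimplexCategory} (f : m ⟶ ⦋n⦌) :
    stdSimplex.objEquiv.symm f ∈ (∂Δ[n] : (Δ[n] : SSet.{u}).Subcomplex).obj (op m) ↔
      ∃ j, ∀ i, f i ≠ j := by
  change ¬ Function.Surjective f ↔ _
  simp [Function.Surjective]

/-- The simplex of the boundary given by a non-surjective map. -/
def boundaryMk {n : ℕ} {m : SimplexCategory} (f : m ⟶ ⦋n⦌) (hf : ∃ j, ∀ i, f i ≠ j) :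
    (∂Δ[n] : SSet.{u}).obj (op m) :=
  ⟨stdSimplex.objEquiv.symm f, (mem_boundary_objEquiv_symm_iff f).mpr hf⟩

theorem exists_boundaryMk_eq {n : ℕ} {m : SimplexCategory} (σ : (∂Δ[n] : SSet.{u}).obj (op m)) :
    ∃ (f : m ⟶ ⦋n⦌) (hf : ∃ j, ∀ i, f i ≠ j), boundaryMk f hf = σ :=
  ⟨stdSimplex.objEquiv σ.1, (mem_boundary_objEquiv_symm_iff _).mp (by simpa using! σ.2),
    Subtype.ext (Equiv.symm_apply_apply _ _)⟩

theorem map_boundaryMk {n : ℕ} {m k : SimplexCategory} (g : k ⟶ m) (f : m ⟶ ⦋n⦌)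
    (hf : ∃ j, ∀ i, f i ≠ j) :
    (∂Δ[n] : SSet.{u}).map g.op (boundaryMk f hf) =
      boundaryMk (g ≫ f) (hf.imp fun _ h i ↦ h (g i)) :=
  rfl

theorem boundaryToStdSimplex_boundaryMk {n : ℕ} {m : SimplexCategory} (f : m ⟶ ⦋n⦌)
    (hf : ∃ j, ∀ i, f i ≠ j) (t : _root_.stdSimplex ℝ (Fin (m.len + 1))) :
    boundaryToStdSimplex.{u} n (realizationMk (boundaryMk f hf) t) =
      _root_.stdSimplex.map f t := by
  rw [boundaryToStdSimplex_mk, boundaryMk, Equiv.apply_symm_apply]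

theorem map_apply_ne_zero_iff {m n : ℕ} (f : Fin m → Fin n) (t : _root_.stdSimplex ℝ (Fin m))
    (i : Fin n) : _root_.stdSimplex.map f t i ≠ 0 ↔ ∃ j, f j = i ∧ t j ≠ 0 := by
  rw [_root_.stdSimplex.map_apply_eq_sum, Ne, Finset.sum_eq_zero_iff_of_nonneg]
  · simp
  · intro j _
    split_ifs
    · exact t.2.1 j
    · exact le_rfl

/-- A point of |∂Δⁿ| is determined by its image in the simplex, which gives injectivity. The maps f
and f ≫ θ agree on the support of t, and precomposing with the retraction η onto that support does
not change the point. -/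
theorem realizationMk_boundaryMk_eq {n : ℕ} {m : SimplexCategory} (f : m ⟶ ⦋n⦌)
    (hf : ∃ j, ∀ i, f i ≠ j) (t : _root_.stdSimplex ℝ (Fin (m.len + 1)))
    (θ : ⦋n⦌ ⟶ ⦋n⦌) (hθ : ∃ j, ∀ i, θ i ≠ j)
    (h : ∀ i, _root_.stdSimplex.map f t i ≠ 0 → θ i = i) :
    realizationMk (boundaryMk.{u} f hf) t =
      realizationMk (boundaryMk θ hθ) (_root_.stdSimplex.map f t) := by
  obtain ⟨η, h1, -, h3⟩ := exists_retraction_support t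
  have key : η ≫ f = η ≫ f ≫ θ := by
    ext i : 3
    exact (h _ ((map_apply_ne_zero_iff _ _ _).mpr ⟨η i, rfl, h1 i⟩)).symm
  calc realizationMk (boundaryMk f hf) t
      = realizationMk (boundaryMk (η ≫ f) (hf.imp fun _ h i ↦ h (η i))) t := by
        conv_lhs => rw [← h3]
        rw [← realizationMk_map, map_boundaryMk]
    _ = realizationMk (boundaryMk (η ≫ f ≫ θ) (hθ.imp fun _ h i ↦ h _)) t := by
        simp only [key]
    _ = realizationMk (boundaryMk (f ≫ θ) (hθ.imp fun _ h i ↦ h _)) t := by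
        conv_rhs => rw [← h3]
        rw [← realizationMk_map, map_boundaryMk]
    _ = realizationMk (boundaryMk θ hθ) (_root_.stdSimplex.map f t) := by
        rw [← realizationMk_map, map_boundaryMk]

theorem exists_retraction_not_surjective {n : ℕ} (q : _root_.stdSimplex ℝ (Fin (n + 1)))
    (hq : ∃ i, q i = 0) : ∃ θ : ⦋n⦌ ⟶ ⦋n⦌, (∃ j, ∀ i, θ i ≠ j) ∧ (∀ i, q i ≠ 0 → θ i = i) ∧
      _root_.stdSimplex.map θ q = q := by
  obtain ⟨θ, h1, h2, h3⟩ := exists_retraction_support (n := ⦋n⦌) q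
  obtain ⟨j, hj⟩ := hq
  exact ⟨θ, ⟨j, fun i hi ↦ h1 i (hi ▸ hj)⟩, h2, h3⟩

theorem exists_map_apply_eq_zero {m n : ℕ} {f : Fin m → Fin n}
    (hf : ∃ j, ∀ i, f i ≠ j) (t : _root_.stdSimplex ℝ (Fin m)) :
    ∃ i, _root_.stdSimplex.map f t i = 0 := by
  obtain ⟨j, hj⟩ := hf
  refine ⟨j, by_contra fun h ↦ ?_⟩
  obtain ⟨i, hi, -⟩ := (map_apply_ne_zero_iff f t j).mp h
  exact hj i hi

theorem exists_boundaryMk_top_eq {n : ℕ} (p : |(∂Δ[n] : SSet.{u})|) :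
    ∃ (θ : ⦋n⦌ ⟶ ⦋n⦌) (hθ : ∃ j, ∀ i, θ i ≠ j),
      p = realizationMk (boundaryMk θ hθ) (boundaryToStdSimplex n p) := by
  obtain ⟨m, σ, t, rfl⟩ := exists_realizationMk_eq p
  obtain ⟨f, hf, rfl⟩ := exists_boundaryMk_eq σ
  obtain ⟨θ, hθ, h, -⟩ := exists_retraction_not_surjective _ (exists_map_apply_eq_zero hf t)
  refine ⟨θ, hθ, ?_⟩
  rw [boundaryToStdSimplex_boundaryMk]
  exact realizationMk_boundaryMk_eq f hf t θ hθ h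

theorem injective_boundaryToStdSimplex (n : ℕ) :
    Function.Injective (boundaryToStdSimplex.{u} n) := by
  intro p p' hpp
  obtain ⟨m, σ, t, rfl⟩ := exists_realizationMk_eq p
  obtain ⟨f, hf, rfl⟩ := exists_boundaryMk_eq σ
  obtain ⟨m', σ', t', rfl⟩ := exists_realizationMk_eq p'
  obtain ⟨f', hf', rfl⟩ := exists_boundaryMk_eq σ'
  rw [boundaryToStdSimplex_boundaryMk, boundaryToStdSimplex_boundaryMk] at hpp
  obtain ⟨θ, hθ, h, -⟩ := exists_retraction_not_surjective _ (exists_map_apply_eq_zero hf t)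
  rw [realizationMk_boundaryMk_eq f hf t θ hθ h, hpp,
    realizationMk_boundaryMk_eq f' hf' t' θ hθ (hpp ▸ h)]

theorem range_boundaryToStdSimplex (n : ℕ) :
    Set.range (boundaryToStdSimplex.{u} n) = {q | ∃ i, q i = 0} := by
  ext q
  constructor
  · rintro ⟨p, rfl⟩
    obtain ⟨m, σ, t, rfl⟩ := exists_realizationMk_eq p
    obtain ⟨f, hf, rfl⟩ := exists_boundaryMk_eq σ
    rw [boundaryToStdSimplex_boundaryMk]
    exact exists_map_apply_eq_zero hf t
  · intro hq
    obtain ⟨θ, hθ, -, h⟩ := exists_retraction_not_surjective q hq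
    exact ⟨realizationMk (boundaryMk θ hθ) q, (boundaryToStdSimplex_boundaryMk θ hθ q).trans h⟩

/-- Finitely many non-surjective endomorphisms θ of ⦋n⦌ give simplices covering everything. -/
instance (n : ℕ) : CompactSpace |(∂Δ[n] : SSet.{u})| := by
  have : Finite (⦋n⦌ ⟶ ⦋n⦌) := Finite.of_injective
    (fun f : ⦋n⦌ ⟶ ⦋n⦌ ↦ (f : Fin (n + 1) → Fin (n + 1)))
    fun f g h ↦ SimplexCategory.Hom.ext _ _ (OrderHom.ext _ _ h)
  have h : (Set.univ : Set |(∂Δ[n] : SSet.{u})|) =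
      ⋃ θ : {θ : ⦋n⦌ ⟶ ⦋n⦌ // ∃ j, ∀ i, θ i ≠ j},
        Set.range (realizationMk (boundaryMk.{u} θ.1 θ.2)) := by
    refine (Set.eq_univ_of_forall fun p ↦ ?_).symm
    obtain ⟨θ, hθ, hp⟩ := exists_boundaryMk_top_eq p
    exact Set.mem_iUnion.mpr ⟨⟨θ, hθ⟩, _, hp.symm⟩
  rw [← isCompact_univ_iff, h]
  exact isCompact_iUnion fun θ ↦ isCompact_range (realizationMk _).continuous

theorem isClosedEmbedding_boundaryToStdSimplex (n : ℕ) :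
    Topology.IsClosedEmbedding (boundaryToStdSimplex.{u} n) :=
  (boundaryToStdSimplex n).continuous.isClosedEmbedding (injective_boundaryToStdSimplex n)

end SSet

end BoundaryRealization

/-! ### The simplex as a Euclidean ball. -/

section SimplexDisk

open Topology Filter

namespace stdSimplex

variable {n : ℕ}

/-- The linear map that forgets the initial barycentric coordinate. -/
noncomputable def tailMap (n : ℕ) : (Fin (n + 1) → ℝ) →L[ℝ] EuclideanSpace ℝ (Fin n) :=
  LinearMap.toContinuousLinearMap
    { toFun := fun t ↦ WithLp.toLp 2 fun i ↦ t i.succ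
      map_add' := fun _ _ ↦ rfl
      map_smul' := fun _ _ ↦ rfl }

theorem tailMap_apply (t : Fin (n + 1) → ℝ) (i : Fin n) : tailMap n t i = t i.succ := rfl

/-- The barycentric coordinates of a point of the Euclidean space in which the simplex is
embedded by `tailMap`. -/
def baryCoord (x : EuclideanSpace ℝ (Fin n)) : Fin (n + 1) → ℝ :=
  Fin.cons (1 - ∑ i, x i) fun i ↦ x i

theorem continuous_baryCoord : Continuous (baryCoord (n := n)) := by
  refine continuous_pi fun j ↦ ?_
  induction j using Fin.cases with
  | zero => simp only [baryCoord, Fin.cons_zero]; fun_prop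
  | succ i => simp only [baryCoord, Fin.cons_succ]; fun_prop

theorem baryCoord_lineMap (x c : EuclideanSpace ℝ (Fin n)) (s : ℝ) (j : Fin (n + 1)) :
    baryCoord (x + s • (x - c)) j = (1 + s) * baryCoord x j - s * baryCoord c j := by
  induction j using Fin.cases with
  | zero =>
    simp only [baryCoord, Fin.cons_zero, PiLp.add_apply, PiLp.smul_apply, PiLp.sub_apply,
      smul_eq_mul, Finset.sum_add_distrib, ← Finset.mul_sum, Finset.sum_sub_distrib]
    ring
  | succ i =>
    simp only [baryCoord, Fin.cons_succ, PiLp.add_apply, PiLp.smul_apply, PiLp.sub_apply,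
      smul_eq_mul]
    ring

theorem tailMap_baryCoord (x : EuclideanSpace ℝ (Fin n)) : tailMap n (baryCoord x) = x := rfl

theorem baryCoord_tailMap {t : Fin (n + 1) → ℝ} (ht : ∑ i, t i = 1) :
    baryCoord (tailMap n t) = t := by
  funext j
  induction j using Fin.cases with
  | zero =>
    rw [Fin.sum_univ_succ] at ht
    simp only [baryCoord, Fin.cons_zero, tailMap_apply]
    linarith
  | succ i => rfl

theorem sum_baryCoord (x : EuclideanSpace ℝ (Fin n)) : ∑ j, baryCoord x j = 1 := by
  simp [Fin.sum_univ_succ, baryCoord]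

theorem mem_image_tailMap_iff (x : EuclideanSpace ℝ (Fin n)) :
    x ∈ tailMap n '' stdSimplex ℝ (Fin (n + 1)) ↔ ∀ j, 0 ≤ baryCoord x j := by
  constructor
  · rintro ⟨t, ht, rfl⟩
    rw [baryCoord_tailMap ht.2]
    exact ht.1
  · exact fun h ↦ ⟨baryCoord x, ⟨h, sum_baryCoord x⟩, tailMap_baryCoord x⟩

theorem mem_interior_image_tailMap_of_pos {x : EuclideanSpace ℝ (Fin n)}
    (hx : ∀ j, 0 < baryCoord x j) : x ∈ interior (tailMap n '' stdSimplex ℝ (Fin (n + 1))) := by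
  refine mem_interior.mpr ⟨{x | ∀ j, 0 < baryCoord x j},
    fun y hy ↦ (mem_image_tailMap_iff y).mpr fun j ↦ (hy j).le, ?_, hx⟩
  simp only [Set.ofPred_forall]
  exact isOpen_iInter_of_finite fun j ↦
    isOpen_lt continuous_const ((continuous_apply j).comp continuous_baryCoord)

theorem exists_baryCoord_pos (n : ℕ) : ∃ c : EuclideanSpace ℝ (Fin n), ∀ j, 0 < baryCoord c j := by
  refine ⟨tailMap n (fun _ ↦ (n + 1 : ℝ)⁻¹), fun j ↦ ?_⟩
  rw [baryCoord_tailMap]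
  · positivity
  · simp [mul_inv_cancel₀ (Nat.cast_add_one_ne_zero n : (n + 1 : ℝ) ≠ 0)]

/-- An interior point can be pushed slightly away from a point c with positive coordinates and stay
inside; a coordinate of x that is not positive would then become negative. -/
theorem mem_interior_image_tailMap_iff (x : EuclideanSpace ℝ (Fin n)) :
    x ∈ interior (tailMap n '' stdSimplex ℝ (Fin (n + 1))) ↔ ∀ j, 0 < baryCoord x j := by
  refine ⟨fun hx j ↦ ?_, mem_interior_image_tailMap_of_pos⟩
  obtain ⟨c, hc⟩ := exists_baryCoord_pos n
  have h0 : ∀ᶠ s in 𝓝 (0 : ℝ), x + s • (x - c) ∈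
      interior (tailMap n '' stdSimplex ℝ (Fin (n + 1))) := by
    have : Continuous fun s : ℝ ↦ x + s • (x - c) := by fun_prop
    exact this.continuousAt.eventually_mem (isOpen_interior.mem_nhds (by simpa using hx))
  obtain ⟨s, hs, hs0⟩ := ((h0.filter_mono nhdsWithin_le_nhds).and
    (self_mem_nhdsWithin : Set.Ioi (0 : ℝ) ∈ 𝓝[>] 0)).exists
  have h1 := (mem_image_tailMap_iff _).mp (interior_subset hs) j
  rw [baryCoord_lineMap] at h1
  have h2 : 0 < s * baryCoord c j := mul_pos hs0 (hc j)
  have h3 : (0 : ℝ) < 1 + s := by have : (0 : ℝ) < s := hs0; linarith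
  exact pos_of_mul_pos_right (by linarith) h3.le

/-- Forgetting one coordinate makes the simplex a convex body with nonempty interior, which a
homeomorphism of the ambient space carries to the ball, frontier to sphere. -/
theorem exists_homeomorph_closedBall (n : ℕ) :
    ∃ Φ : stdSimplex ℝ (Fin (n + 1)) ≃ₜ Metric.closedBall (0 : EuclideanSpace ℝ (Fin n)) 1,
      ∀ q, ‖(Φ q : EuclideanSpace ℝ (Fin n))‖ = 1 ↔ ∃ i, q i = 0 := by
  set K := tailMap n '' stdSimplex ℝ (Fin (n + 1)) with hK
  have hKc : IsCompact K := (isCompact_stdSimplex ℝ (Fin (n + 1))).image (tailMap n).continuous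
  obtain ⟨c, hc⟩ := exists_baryCoord_pos n
  obtain ⟨h, -, h2, h3⟩ := exists_homeomorph_image_interior_closure_frontier_eq_unitBall
    ((convex_stdSimplex ℝ (Fin (n + 1))).linear_image (tailMap n).toLinearMap)
    ⟨c, mem_interior_image_tailMap_of_pos hc⟩ hKc.isBounded
  change h '' closure K = _ at h2
  change h '' frontier K = _ at h3
  rw [hKc.isClosed.closure_eq] at h2
  let φ (q : stdSimplex ℝ (Fin (n + 1))) : Metric.closedBall (0 : EuclideanSpace ℝ (Fin n)) 1 :=
    ⟨h (tailMap n q.1), h2 ▸ Set.mem_image_of_mem h (Set.mem_image_of_mem _ q.2)⟩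
  have hφ : Continuous φ := by
    refine Continuous.subtype_mk ?_ _
    exact h.continuous.comp ((tailMap n).continuous.comp continuous_subtype_val)
  have hbij : Function.Bijective φ := by
    constructor
    · intro q q' hq
      have h4 := h.injective (congrArg Subtype.val hq)
      refine Subtype.ext ?_
      rw [← baryCoord_tailMap q.2.2, ← baryCoord_tailMap q'.2.2, h4]
    · rintro ⟨y, hy⟩
      rw [← h2] at hy
      obtain ⟨_, ⟨t, ht, rfl⟩, rfl⟩ := hy
      exact ⟨⟨t, ht⟩, rfl⟩
  refine ⟨Continuous.homeoOfEquivCompactToT2 (f := Equiv.ofBijective φ hbij) hφ, fun q ↦ ?_⟩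
  change ‖h (tailMap n q.1)‖ = 1 ↔ _
  rw [← mem_sphere_zero_iff_norm, ← h3, h.injective.mem_set_image, hKc.isClosed.frontier_eq,
    Set.mem_sdiff, hK, mem_interior_image_tailMap_iff, baryCoord_tailMap q.2.2]
  have hq : ∀ i, 0 ≤ q i := q.2.1
  refine ⟨fun h5 ↦ ?_, fun ⟨i, hi⟩ ↦ ⟨⟨q.1, q.2, rfl⟩, fun h5 ↦ (h5 i).ne' hi⟩⟩
  obtain ⟨i, hi⟩ := not_forall.mp h5.2
  exact ⟨i, le_antisymm (not_lt.mp hi) (hq i)⟩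

end stdSimplex

end SimplexDisk

/-! ### Realizations are CW complexes. -/

section RealizationCW

open Simplicial Opposite Limits HomotopicalAlgebra

/-- Embeddings whose targets correspond under a homeomorphism that matches their ranges are
isomorphic. -/
theorem TopCat.nonempty_arrow_iso_of_isEmbedding {A B A' B' : TopCat.{u}} (f : A ⟶ B)
    (g : A' ⟶ B') (hf : Topology.IsEmbedding f) (hg : Topology.IsEmbedding g) (e : B ≃ₜ B')
    (h : Set.range (e ∘ f) = Set.range g) : Nonempty (Arrow.mk f ≅ Arrow.mk g) := by
  let d : A ≃ₜ A' := (e.isEmbedding.comp hf).toHomeomorph.trans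
    ((Homeomorph.setCongr h).trans hg.toHomeomorph.symm)
  refine ⟨Arrow.isoMk (TopCat.isoOfHomeo d) (TopCat.isoOfHomeo e) ?_⟩
  ext a
  change g (d a) = e (f a)
  have := congrArg Subtype.val (hg.toHomeomorph.apply_symm_apply
    (Homeomorph.setCongr h ((e.isEmbedding.comp hf).toHomeomorph a)))
  exact this

theorem SSet.nonempty_boundary_arrow_iso (n : ℕ) :
    Nonempty (Arrow.mk (SSet.toTop.map (∂Δ[n] : (Δ[n] : SSet.{u}).Subcomplex).ι) ≅
      Arrow.mk (TopCat.diskBoundaryInclusion.{u} n)) := by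
  obtain ⟨Φ, hΦ⟩ := stdSimplex.exists_homeomorph_closedBall n
  let e : |(Δ[n] : SSet.{u})| ≃ₜ (TopCat.disk.{u} n) :=
    (SimplexCategory.toTopHomeo.{u} ⦋n⦌).trans (Φ.trans Homeomorph.ulift.symm)
  have hf : Topology.IsEmbedding (SSet.toTop.map (∂Δ[n] : (Δ[n] : SSet.{u}).Subcomplex).ι) :=
    ((SimplexCategory.toTopHomeo.{u} ⦋n⦌).isEmbedding.of_comp_iff).mp
      (SSet.isClosedEmbedding_boundaryToStdSimplex n).isEmbedding
  have hg : Topology.IsEmbedding (TopCat.diskBoundaryInclusion.{u} n) := by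
    have : Topology.IsEmbedding (Set.inclusion
      (Metric.sphere_subset_closedBall (x := (0 : EuclideanSpace ℝ (Fin n))) (ε := 1))) :=
      Topology.IsEmbedding.inclusion _
    exact Homeomorph.ulift.symm.isEmbedding.comp (this.comp Homeomorph.ulift.isEmbedding)
  refine TopCat.nonempty_arrow_iso_of_isEmbedding _ _ hf hg e ?_
  ext ⟨y, hy⟩
  constructor
  · rintro ⟨p, hp⟩
    have h1 : Φ (SSet.boundaryToStdSimplex n p) = ⟨y, hy⟩ := congrArg ULift.down hp
    have h2 := (hΦ _).mpr
      ((SSet.range_boundaryToStdSimplex n).subset (Set.mem_range_self p))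
    rw [h1] at h2
    exact ⟨⟨y, mem_sphere_zero_iff_norm.mpr h2⟩, rfl⟩
  · rintro ⟨⟨z, hz⟩, hzy⟩
    have h0 : z = y := congrArg (fun w : TopCat.disk.{u} n ↦ w.down.1) hzy
    subst h0
    obtain ⟨q, hq⟩ := Φ.surjective ⟨z, hy⟩
    have h1 : ∃ i, q i = 0 := (hΦ q).mp (by rw [hq]; exact mem_sphere_zero_iff_norm.mp hz)
    obtain ⟨p, rfl⟩ := (SSet.range_boundaryToStdSimplex.{u} n).superset h1
    exact ⟨p, congrArg ULift.up hq⟩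

/-- The geometric realization of a simplicial set is a CW complex. -/
theorem SSet.nonempty_cwComplex_realization (X : SSet.{u}) : Nonempty (TopCat.CWComplex |X|) := by
  have e (n : ℕ) := (SSet.nonempty_boundary_arrow_iso.{u} n).some
  have hbot : IsInitial (SSet.toTop.obj ((⊥ : X.Subcomplex) : SSet.{u})) :=
    Subcomplex.isInitialBot.isInitialObj SSet.toTop
  have ef : Arrow.mk (SSet.toTop.map (Subcomplex.ι (⊥ : X.Subcomplex))) ≅
      Arrow.mk (initial.to |X|) :=
    Arrow.isoMk (hbot.uniqueUpToIso initialIsInitial) (Iso.refl _) (hbot.hom_ext _ _)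
  exact ⟨(SSet.relativeCellComplex X).mapFunctor SSet.toTop e ef⟩

end RealizationCW

theorem isEilenbergMacLaneOne_BG (G : Type u) [Group G] : IsEilenbergMacLaneOne G (BG G) where
  cwComplex := SSet.nonempty_cwComplex_realization _
  pathConnected :=
    (BrG.isQuotientCoveringMap_toBG G).surjective.pathConnectedSpace (BrG.toBG G).continuous
  pi_one x := by
    have hp := BrG.isQuotientCoveringMap_toBG G
    obtain ⟨e, he⟩ := hp.surjective x
    -- The deck action identifies the fundamental group with the opposite group of G; inversion
    -- turns this into G.
    exact ⟨HomotopyGroup.pi1MulEquivFundamentalGroup.trans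
      ((hp.fundamentalGroupEquiv ⟨e, he⟩).trans (MulEquiv.inv' G).symm)⟩
  pi_higher n hn x := by
    have hp := BrG.isQuotientCoveringMap_toBG G
    have : Nontrivial (Fin n) := Fin.nontrivial_iff_two_le.mpr hn
    exact hp.isCoveringMap.subsingleton_homotopyGroup hp.surjective (Fin n) x

theorem theorem6 (G : Type u) [Group G] :
    IsEilenbergMacLaneOne G (BG G) ∧
    ∃ e : MulAction.orbitRel.Quotient G (BrG G) ≃ₜ BG G,
      ∀ p : BrG G, e (Quotient.mk _ p) = BrG.toBG G p :=
  ⟨isEilenbergMacLaneOne_BG G, BrG.orbitHomeo G, BrG.orbitHomeo_mk⟩
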